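/- Embed the hexagonal lattice $\mathbb{H}$ in $\mathbb{C}$ so that its faces are centred at the points $s+te^{i\pi/3}$, $s,t\in\mathbb{Z}$. For integers $k,\ell\ge 1$ let $\mathsf{Tor}_{k,\ell}$ be the $k\times\ell$ hexagonal torus, i.e. the quotient of $\mathbb{H}$ by the translations $k$ and $\ell e^{i\pi/3}$ (a graph, with parallel edges if $k=1$ or $\ell=1$, embedded in the continuous torus $\mathbb{C}/(k\mathbb{Z}+\ell e^{i\pi/3}\mathbb{Z})$). A loop configuration $\omega$ is a spanning subgraph of $\mathsf{Tor}_{k,\ell}$ in which every vertex has even degree; its loops are the subgraphs of $\omega$ that are cycles, $|\omega|$ is the number of its edges and $\ell(\omega)$ the number of its loops. For $n,x>0$ the loop $O(n)$ measure $\mathbb{P}_{\mathsf{Tor}_{k,\ell},n,x}$ is the probability measure on loop configurations that gives $\omega$ a probability proportional to $x^{|\omega|}n^{\ell(\omega)}$. A loop is non-contractible if, as a closed curve in the continuous torus, it is not homotopic to a point. Theorem. For every real $n\in[1,2]$ and all integers $k,\ell\ge 1$, \[ \mathbb{P}_{\mathsf{Tor}_{k,\ell},n,1}\bigl(\text{there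 exists a non-contractible loop}\bigr)\ \ge\ \tfrac14 . \] -/

import Mathlib

namespace LoopModel

/-! ### The `k × l` hexagonal torus as a finite graph

The faces of the hexagonal lattice are centred at the points `s + t ζ` of the complex plane, where
`ζ = exp (iπ/3)` and `s, t` are integers; a lattice vertex is the centre of a triangle formed by
three pairwise adjacent face centres. Dividing by the translations `k` and `l ζ` gives the torus,
with `k * l` faces, `2 * k * l` vertices and `3 * k * l` edges. When `k = 1` or `l = 1` the quotient
has parallel edges, so edges are recorded by name and not by their two ends. -/

/-- Faces: the class of `(s, t)` is the face centred at `s + t ζ`. -/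
abbrev Face (k l : ℕ) : Type := ZMod k × ZMod l

/-- Vertices. For the face `f` centred at `c`, the vertex `up f` is the centre of the triangle
`c, c + 1, c + ζ`, and `down f` is the centre of the triangle `c + 1, c + ζ, c + 1 + ζ`. -/
inductive Vertex (k l : ℕ) : Type
  | up (f : Face k l)
  | down (f : Face k l)

/-- Edges: `(f, i)` is the `i`-th of the three edges at the vertex `up f`. Every edge has exactly
one end of the form `up f` and one end of the form `down g`. -/
abbrev Edge (k l : ℕ) : Type := Face k l × Fin 3

/-- The translations `0, 1, ζ`, in the coordinates of the faces. -/
def shift (k l : ℕ) : Fin 3 → Face k l := ![0, (1, 0), (0, 1)]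

/-- The `up` end of an edge. -/
def Edge.upEnd {k l : ℕ} (e : Edge k l) : Vertex k l := .up e.1

/-- The `down` end of an edge: `up f` is adjacent to `down f`, `down (f - 1)`, `down (f - ζ)`. -/
def Edge.downEnd {k l : ℕ} (e : Edge k l) : Vertex k l := .down (e.1 - shift k l e.2)

/-- The vertex `v` is an end of the edge `e`. -/
def Incident {k l : ℕ} (v : Vertex k l) (e : Edge k l) : Prop :=
  Edge.upEnd e = v ∨ Edge.downEnd e = v

/-! ### The continuous torus and the embedding of the graph -/

/-- The sixth root of unity `exp (iπ/3)`. -/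
noncomputable def ζ : ℂ := Complex.exp ((Real.pi / 3 : ℝ) * Complex.I)

/-- The group of translations of the plane generated by `k` and `l ζ`. -/
noncomputable def period (k l : ℕ) : AddSubgroup ℂ :=
  AddSubgroup.closure {(k : ℂ), (l : ℂ) * ζ}

/-- The continuous torus, with the quotient topology. -/
abbrev Torus (k l : ℕ) : Type := ℂ ⧸ period k l

/-- The projection of the plane to the torus. -/
noncomputable def proj (k l : ℕ) : ℂ →+ Torus k l := QuotientAddGroup.mk' (period k l)

lemma continuous_proj (k l : ℕ) : Continuous (proj k l) := continuous_quot_mk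

lemma proj_left (k l : ℕ) : proj k l (k : ℂ) = 0 :=
  (QuotientAddGroup.eq_zero_iff _).2 (AddSubgroup.subset_closure (by simp))

lemma proj_right (k l : ℕ) : proj k l ((l : ℂ) * ζ) = 0 :=
  (QuotientAddGroup.eq_zero_iff _).2 (AddSubgroup.subset_closure (by simp))

/-- The centre of a face: the class of `(s, t)` is sent to the class of `s + t ζ`. -/
noncomputable def center (k l : ℕ) : Face k l →+ Torus k l :=
  AddMonoidHom.coprod
    (ZMod.lift k ⟨zmultiplesHom _ (proj k l 1), by
      have h := proj_left k l
      simp only [zmultiplesHom_apply, ← map_zsmul]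
      simpa using h⟩)
    (ZMod.lift l ⟨zmultiplesHom _ (proj k l ζ), by
      have h := proj_right k l
      simp only [zmultiplesHom_apply, ← map_zsmul]
      simpa using h⟩)

/-- The vector from the centre of the face `f` to the vertex `up f`. The vector to `down f` is
twice as long. -/
noncomputable def corner : ℂ := (1 + ζ) / 3

/-- The position of a vertex in the torus. -/
noncomputable def Vertex.pos {k l : ℕ} : Vertex k l → Torus k l
  | .up f => center k l f + proj k l corner
  | .down f => center k l f + proj k l (2 * corner)

/-- The translations `0, 1, ζ` of the plane. -/
noncomputable def shiftC : Fin 3 → ℂ := ![0, 1, ζ]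

lemma center_shift (k l : ℕ) (i : Fin 3) : center k l (shift k l i) = proj k l (shiftC i) := by
  have h1 (A : Type) [AddGroup A] (m : ℕ) (f : {f : ℤ →+ A // f m = 0}) :
      ZMod.lift m f 1 = f.1 1 := by
    simpa using ZMod.lift_coe m f 1
  fin_cases i <;> simp [center, shift, shiftC, h1]

/-- An edge as a straight segment in the torus, from its `up` end to its `down` end. -/
noncomputable def Edge.segment {k l : ℕ} (e : Edge k l) :
    Path (Vertex.pos (Edge.upEnd e)) (Vertex.pos (Edge.downEnd e)) where
  toFun t := Vertex.pos (Edge.upEnd e) + proj k l (((t : ℝ) : ℂ) * (corner - shiftC e.2))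
  continuous_toFun := by
    refine continuous_const.add ((continuous_proj k l).comp ?_)
    fun_prop
  source' := by simp
  target' := by
    simp only [Edge.upEnd, Edge.downEnd, Vertex.pos, map_sub, center_shift, Set.Icc.coe_one,
      Complex.ofReal_one, one_mul, two_mul, map_add]
    abel

/-! ### Walks, cycles and contractibility -/

/-- An edge with a choice of direction, from one of its ends to the other. -/
inductive Step {k l : ℕ} : Vertex k l → Vertex k l → Type
  | fwd (e : Edge k l) : Step (Edge.upEnd e) (Edge.downEnd e)
  | bwd (e : Edge k l) : Step (Edge.downEnd e) (Edge.upEnd e)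

/-- The edge that is traversed. -/
def Step.edge {k l : ℕ} : {u v : Vertex k l} → Step u v → Edge k l
  | _, _, .fwd e => e
  | _, _, .bwd e => e

/-- The segment that is traversed. -/
noncomputable def Step.curve {k l : ℕ} : {u v : Vertex k l} → Step u v → Path u.pos v.pos
  | _, _, .fwd e => Edge.segment e
  | _, _, .bwd e => (Edge.segment e).symm

/-- Walks in the torus graph. -/
inductive Walk {k l : ℕ} : Vertex k l → Vertex k l → Type
  | nil (u : Vertex k l) : Walk u u
  | cons {u v w : Vertex k l} (s : Step u v) (p : Walk v w) : Walk u w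

/-- The edges of a walk, in order. -/
def Walk.edges {k l : ℕ} : {u v : Vertex k l} → Walk u v → List (Edge k l)
  | _, _, .nil _ => []
  | _, _, .cons s p => s.edge :: p.edges

/-- The vertices from which the steps of a walk start, in order (all vertices but the last). -/
def Walk.starts {k l : ℕ} : {u v : Vertex k l} → Walk u v → List (Vertex k l)
  | _, _, .nil _ => []
  | u, _, .cons _ p => u :: p.starts

/-- The curve in the torus that a walk runs through. -/
noncomputable def Walk.curve {k l : ℕ} : {u v : Vertex k l} → Walk u v → Path u.pos v.pos
  | _, _, .nil u => Path.refl u.pos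
  | _, _, .cons s p => s.curve.trans p.curve

/-- A closed walk that is not constant and repeats no edge and no vertex
(apart from returning to its start). -/
def Walk.IsCycle {k l : ℕ} {v : Vertex k l} (p : Walk v v) : Prop :=
  p.edges ≠ [] ∧ p.edges.Nodup ∧ p.starts.Nodup

/-- The closed walk `p` is a cycle whose set of edges is `γ`. -/
def Walk.Traverses {k l : ℕ} {v : Vertex k l} (p : Walk v v) (γ : Finset (Edge k l)) : Prop :=
  p.IsCycle ∧ ∀ e, e ∈ γ ↔ e ∈ p.edges

/-- A loop: (the set of edges of) a subgraph that is a cycle. -/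
def IsLoop {k l : ℕ} (γ : Finset (Edge k l)) : Prop :=
  ∃ (v : Vertex k l) (p : Walk v v), p.Traverses γ

/-- A loop that, as a closed curve in the continuous torus, is not homotopic to a point. -/
def IsNoncontractibleLoop {k l : ℕ} (γ : Finset (Edge k l)) : Prop :=
  ∃ (v : Vertex k l) (p : Walk v v), p.Traverses γ ∧ ¬ p.curve.Homotopic (Path.refl v.pos)

/-! ### The loop `O(n)` model -/

open Classical in
/-- Loop configurations: spanning subgraphs, given by their sets of edges, in which every vertex
has even degree. -/
def IsLoopConfig {k l : ℕ} (ω : Finset (Edge k l)) : Prop :=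
  ∀ v : Vertex k l, Even (ω.filter (fun e => Incident v e)).card

open Classical in
/-- The loops of a configuration. -/
noncomputable def loops {k l : ℕ} (ω : Finset (Edge k l)) : Finset (Finset (Edge k l)) :=
  ω.powerset.filter (fun γ => IsLoop γ)

/-- The weight `x ^ (number of edges) * n ^ (number of loops)`. -/
noncomputable def weight {k l : ℕ} (n x : ℝ) (ω : Finset (Edge k l)) : ℝ :=
  x ^ ω.card * n ^ (loops ω).card

open Classical in
/-- The partition function: the sum of the weights of all loop configurations. -/
noncomputable def partitionFunction (k l : ℕ) [NeZero k] [NeZero l] (n x : ℝ) : ℝ :=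
  ∑ ω : Finset (Edge k l) with IsLoopConfig ω, weight n x ω

open Classical in
/-- The probability of the event `A` in the loop `O(n)` model on the torus, with edge weight `x`. -/
noncomputable def prob (k l : ℕ) [NeZero k] [NeZero l] (n x : ℝ)
    (A : Set (Finset (Edge k l))) : ℝ :=
  ∑ ω : Finset (Edge k l) with IsLoopConfig ω ∧ ω ∈ A, weight n x ω / partitionFunction k l n x

end LoopModel

/-! Colour each loop blue with weight `n - 1` or red with weight 1. As `n = (n - 1) + 1`, summing
over colourings gives back `n ^ (number of loops)` (`IsLoopConfig.pow_card_loops`), so the model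
becomes a measure on pairs `(B, R)` of disjoint even subgraphs (`sum_pairs`). At `x = 1` the weight
does not depend on `R`: given `B`, the red part is uniform among the even subgraphs off `B`.

Say that an even subgraph winds if it crosses one of two standard closed curves an odd number of
times. If some even subgraph off `B` winds, adding it modulo 2 shows that at least half of them do
(`card_evenOff_le`). A winding even subgraph contains a winding loop, which is noncontractible
because a contractible closed curve lifts to a closed curve under the coordinate maps to circles
(`IsCoordinate.sum_eq_zero`).

It remains to see that `B` leaves room for a winding subgraph with probability at least 1/2. Of two
disjoint even subgraphs, at least one leaves room (`exists_cross_ne_zero`): otherwise linear duality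
makes the two crossing cocycles cohomologous to cocycles supported on edge sets without common
vertices, whose cup product is 0, while it should be 1. Since a loop is blue with probability `(n -
1) / n ≤ 1/2`, two disjoint copies of `B` can be coupled inside the same configuration
(`pow_le_two_mul_sum`). The two factors 1/2 give 1/4. -/

namespace LoopModel

/-! ### Even subgraphs of a cubic graph -/

variable {k l : ℕ}

/-- The three edges at a vertex. -/
def star : Vertex k l → Fin 3 → Edge k l
  | .up f, i => (f, i)
  | .down f, i => (f + shift k l i, i)

lemma star_snd (v : Vertex k l) (i : Fin 3) : (star v i).2 = i := by
  cases v <;> rfl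

lemma star_injective (v : Vertex k l) : Function.Injective (star v) := fun i j h => by
  rw [← star_snd v i, h, star_snd]

lemma incident_iff {v : Vertex k l} {e : Edge k l} : Incident v e ↔ ∃ i, star v i = e := by
  obtain ⟨f, j⟩ := e
  cases v with
  | up g => simp [Incident, Edge.upEnd, Edge.downEnd, star, eq_comm]
  | down g =>
    simp only [Incident, Edge.upEnd, Edge.downEnd, star, reduceCtorEq, Vertex.down.injEq, false_or,
      Prod.mk.injEq, exists_eq_right]
    rw [sub_eq_iff_eq_add, eq_comm]

open Classical in
/-- The indicator of a set of edges, with values in the field with two elements. -/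
noncomputable def ind (ω : Finset (Edge k l)) (e : Edge k l) : ZMod 2 := if e ∈ ω then 1 else 0

open Classical in
lemma isLoopConfig_iff {ω : Finset (Edge k l)} :
    IsLoopConfig ω ↔ ∀ v : Vertex k l, ∑ i, ind ω (star v i) = 0 := by
  refine forall_congr' fun v => ?_
  rw [← ZMod.natCast_eq_zero_iff_even]
  have h : ω.filter (fun e => Incident v e) =
      (Finset.univ.filter (fun i => star v i ∈ ω)).image (star v) := by
    ext e
    simp only [Finset.mem_filter, incident_iff, Finset.mem_image, Finset.mem_univ, true_and]
    constructor
    · rintro ⟨he, i, rfl⟩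
      exact ⟨i, he, rfl⟩
    · rintro ⟨i, hi, rfl⟩
      exact ⟨hi, i, rfl⟩
  rw [h, Finset.card_image_of_injective _ (star_injective v), Finset.card_filter]
  simp [ind]

/-- In an even subgraph of a cubic graph, the edges at a vertex are none or exactly two. -/
lemma isLoopConfig_iff' {ω : Finset (Edge k l)} :
    IsLoopConfig ω ↔ ∀ v : Vertex k l, (star v 0 ∈ ω ↔ (star v 1 ∈ ω ↔ star v 2 ∉ ω)) := by
  rw [isLoopConfig_iff]
  refine forall_congr' fun v => ?_
  simp only [ind, Fin.sum_univ_three]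
  by_cases h0 : star v 0 ∈ ω <;> by_cases h1 : star v 1 ∈ ω <;> by_cases h2 : star v 2 ∈ ω <;>
    simp [h0, h1, h2] <;> decide

namespace IsLoopConfig

lemma empty : IsLoopConfig (∅ : Finset (Edge k l)) := fun v => by simp

open Classical in
lemma symmDiff {ω η : Finset (Edge k l)} (hω : IsLoopConfig ω) (hη : IsLoopConfig η) :
    IsLoopConfig (symmDiff ω η) := by
  rw [isLoopConfig_iff'] at *
  intro v
  have h1 := hω v
  have h2 := hη v
  simp only [Finset.mem_symmDiff]
  tauto

open Classical in
lemma sdiff {ω η : Finset (Edge k l)} (hω : IsLoopConfig ω) (hη : IsLoopConfig η) (h : η ⊆ ω) :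
    IsLoopConfig (ω \ η) := by
  have := hω.symmDiff hη
  rwa [symmDiff_of_ge h] at this

open Classical in
lemma union {ω η : Finset (Edge k l)} (hω : IsLoopConfig ω) (hη : IsLoopConfig η)
    (h : Disjoint ω η) : IsLoopConfig (ω ∪ η) := by
  have := hω.symmDiff hη
  rwa [h.symmDiff_eq_sup] at this

/-- Disjoint even subgraphs of a cubic graph have no common vertex. -/
lemma star_notMem {ω η : Finset (Edge k l)} (hω : IsLoopConfig ω) (hη : IsLoopConfig η)
    (h : Disjoint ω η) {v : Vertex k l} {i j : Fin 3} (hi : star v i ∈ ω) : star v j ∉ η := by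
  rw [isLoopConfig_iff'] at *
  have h1 := hω v
  have h2 := hη v
  have h0 : ∀ i, star v i ∈ ω → star v i ∉ η := fun i hi hi' => Finset.disjoint_left.1 h hi hi'
  have ha := h0 0
  have hb := h0 1
  have hc := h0 2
  fin_cases i <;> fin_cases j <;> simp only [Fin.zero_eta, Fin.mk_one, Fin.reduceFinMk] at hi ⊢ <;>
    tauto

open Classical in
-- At each vertex `ω` has no edge or two, and `γ` and `δ` each contain all or none of them. In
-- general the intersection of even subgraphs is not even.
lemma inter {ω γ δ : Finset (Edge k l)} (hω : IsLoopConfig ω) (hγ : IsLoopConfig γ)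
    (hδ : IsLoopConfig δ) (h1 : γ ⊆ ω) (h2 : δ ⊆ ω) : IsLoopConfig (γ ∩ δ) := by
  rw [isLoopConfig_iff'] at *
  intro v
  have a := hω v
  have b := hγ v
  have c := hδ v
  have d0 := @h1 (star v 0)
  have d1 := @h1 (star v 1)
  have d2 := @h1 (star v 2)
  have e0 := @h2 (star v 0)
  have e1 := @h2 (star v 1)
  have e2 := @h2 (star v 2)
  simp only [Finset.mem_inter]
  grind

/-- If two distinct edges at a vertex lie in the even subgraph `γ`, then an even subgraph of `γ`
contains both or none. -/
lemma mem_iff_of_subset {γ δ : Finset (Edge k l)} (hγ : IsLoopConfig γ) (hδ : IsLoopConfig δ)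
    (h : δ ⊆ γ) {v : Vertex k l} {i j : Fin 3} (hij : i ≠ j) (hi : star v i ∈ γ)
    (hj : star v j ∈ γ) : star v i ∈ δ ↔ star v j ∈ δ := by
  rw [isLoopConfig_iff'] at *
  have b := hγ v
  have c := hδ v
  have d0 := @h (star v 0)
  have d1 := @h (star v 1)
  have d2 := @h (star v 2)
  fin_cases i <;> fin_cases j <;>
    simp only [Fin.zero_eta, Fin.mk_one, Fin.reduceFinMk] at hi hj hij ⊢ <;> grind

/-- Every edge at a vertex of an even subgraph is followed by another one. -/
lemma exists_ne {γ : Finset (Edge k l)} (hγ : IsLoopConfig γ) {v : Vertex k l} {i : Fin 3}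
    (hi : star v i ∈ γ) : ∃ j, j ≠ i ∧ star v j ∈ γ := by
  rw [isLoopConfig_iff'] at hγ
  have b := hγ v
  by_contra! hc
  have h0 := hc 0
  have h1 := hc 1
  have h2 := hc 2
  fin_cases i <;> simp only [Fin.zero_eta, Fin.mk_one, Fin.reduceFinMk] at * <;> grind

end IsLoopConfig

/-! ### Cycles are the minimal nonempty even subgraphs -/

lemma Step.incident_left {u v : Vertex k l} (s : Step u v) : Incident u s.edge := by
  cases s <;> simp [Incident, Step.edge]

lemma Step.incident_right {u v : Vertex k l} (s : Step u v) : Incident v s.edge := by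
  cases s <;> simp [Incident, Step.edge]

lemma Step.ne {u v : Vertex k l} (s : Step u v) : u ≠ v := by
  cases s <;> simp [Edge.upEnd, Edge.downEnd]

lemma Step.incident_iff {u v w : Vertex k l} (s : Step u v) :
    Incident w s.edge ↔ w = u ∨ w = v := by
  cases s <;> simp only [Incident, Step.edge, eq_comm, or_comm]

lemma exists_step {u : Vertex k l} {e : Edge k l} (h : Incident u e) :
    ∃ (w : Vertex k l) (s : Step w u), s.edge = e := by
  rcases h with rfl | rfl
  · exact ⟨_, .bwd e, rfl⟩
  · exact ⟨_, .fwd e, rfl⟩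

open Classical in
-- Telescoping modulo 2: every intermediate visit to `w` is counted once on arrival and once on
-- departure.
lemma Walk.sum_incident {u v : Vertex k l} (p : Walk u v) (w : Vertex k l) :
    (p.edges.map fun e => if Incident w e then (1 : ZMod 2) else 0).sum =
      (if w = u then 1 else 0) + (if w = v then 1 else 0) := by
  induction p with
  | nil u => simp only [Walk.edges, List.map_nil, List.sum_nil, CharTwo.add_self_eq_zero]
  | @cons u v x s p ih =>
    simp only [Walk.edges, List.map_cons, List.sum_cons, ih, s.incident_iff]
    by_cases h1 : w = u
    · have h2 : w ≠ v := fun h => s.ne (h1.symm.trans h)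
      simp [h1, h1 ▸ h2]
    · simp only [h1, false_or, if_false, zero_add, ← add_assoc, CharTwo.add_self_eq_zero]

lemma Walk.Traverses.sum_eq {v : Vertex k l} {p : Walk v v} {γ : Finset (Edge k l)}
    (h : p.Traverses γ) {M : Type*} [AddCommMonoid M] (f : Edge k l → M) :
    ∑ e ∈ γ, f e = (p.edges.map f).sum := by
  classical
  have : γ = p.edges.toFinset := by
    ext e
    simp [h.2]
  rw [this, List.sum_toFinset f h.1.2.1]

lemma IsLoop.isLoopConfig {γ : Finset (Edge k l)} (h : IsLoop γ) : IsLoopConfig γ := by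
  obtain ⟨v, p, h⟩ := h
  intro w
  rw [← ZMod.natCast_eq_zero_iff_even, Finset.card_filter, Nat.cast_sum]
  simp only [Nat.cast_ite, Nat.cast_one, Nat.cast_zero]
  rw [h.sum_eq, p.sum_incident w, CharTwo.add_self_eq_zero]

lemma IsLoop.nonempty {γ : Finset (Edge k l)} (h : IsLoop γ) : γ.Nonempty := by
  obtain ⟨v, p, h⟩ := h
  obtain ⟨e, he⟩ := List.exists_mem_of_ne_nil _ h.1.1
  exact ⟨e, (h.2 e).2 he⟩

/-- Membership in `δ` propagates along the walk: consecutive edges are distinct edges of `γ` at a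
common vertex. The extra step `s` carries the induction. -/
lemma Walk.mem_iff_of_subset {γ δ : Finset (Edge k l)} (hγ : IsLoopConfig γ)
    (hδ : IsLoopConfig δ) (h : δ ⊆ γ) {v w : Vertex k l} (p : Walk v w) :
    ∀ {u : Vertex k l} (s : Step u v), s.edge ∈ γ → (∀ e ∈ p.edges, e ∈ γ) →
      (s.edge :: p.edges).Nodup → ∀ e ∈ p.edges, (e ∈ δ ↔ s.edge ∈ δ) := by
  induction p with
  | nil => simp [Walk.edges]
  | @cons v x w t p ih =>
    intro u s hs hp hn e he
    obtain ⟨i, hi⟩ := LoopModel.incident_iff.1 s.incident_right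
    obtain ⟨j, hj⟩ := LoopModel.incident_iff.1 t.incident_left
    simp only [Walk.edges, List.mem_cons, forall_eq_or_imp, List.nodup_cons, not_or] at hp hn he
    have key : s.edge ∈ δ ↔ t.edge ∈ δ := by
      rw [← hi, ← hj]
      refine hγ.mem_iff_of_subset hδ h ?_ (hi ▸ hs) (hj ▸ hp.1)
      rintro rfl
      exact hn.1.1 (hi.symm.trans hj)
    rcases he with rfl | he
    · exact key.symm
    · rw [key]
      exact ih t hp.1 hp.2 (List.nodup_cons.2 hn.2) e he

lemma IsLoop.eq_of_subset {γ δ : Finset (Edge k l)} (h : IsLoop γ) (hδ : IsLoopConfig δ)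
    (hs : δ ⊆ γ) (hne : δ.Nonempty) : δ = γ := by
  have hγ := h.isLoopConfig
  obtain ⟨v, p, ⟨-, hn, -⟩, hp⟩ := h
  obtain ⟨d, hd⟩ := hne
  refine hs.antisymm fun e he => ?_
  cases p with
  | nil => exact absurd ((hp e).1 he) (by simp [Walk.edges])
  | cons s p =>
    have hs' : s.edge ∈ γ := (hp _).2 (by simp [Walk.edges])
    have key : ∀ e ∈ γ, (e ∈ δ ↔ s.edge ∈ δ) := by
      intro e he
      have he' := (hp e).1 he
      simp only [Walk.edges, List.mem_cons] at he'
      rcases he' with rfl | he'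
      · exact Iff.rfl
      · exact p.mem_iff_of_subset hγ hδ hs s hs' (fun e he => (hp e).2 (by simp [Walk.edges, he]))
          hn e he'
    exact (key e he).2 ((key d (hs hd)).1 hd)

lemma Walk.exists_incident_of_mem_edges {u v : Vertex k l} (p : Walk u v) {e : Edge k l}
    (he : e ∈ p.edges) : ∃ x ∈ p.starts, Incident x e := by
  induction p with
  | nil => simp [Walk.edges] at he
  | @cons u v w s p ih =>
    simp only [Walk.edges, List.mem_cons] at he
    rcases he with rfl | he
    · exact ⟨u, by simp [Walk.starts], s.incident_left⟩
    · obtain ⟨x, hx, h⟩ := ih he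
      exact ⟨x, by simp [Walk.starts, hx], h⟩

lemma Walk.exists_prefix {u v w : Vertex k l} (p : Walk u v) (hw : w ∈ p.starts) :
    ∃ q : Walk u w, q.edges.Sublist p.edges ∧ q.starts.Sublist p.starts ∧ w ∉ q.starts := by
  induction p with
  | nil => simp [Walk.starts] at hw
  | @cons u v x s p ih =>
    by_cases h : w = u
    · subst h
      exact ⟨.nil w, by simp [Walk.edges], by simp [Walk.starts], by simp [Walk.starts]⟩
    · simp only [Walk.starts, List.mem_cons, h, false_or] at hw
      obtain ⟨q, h1, h2, h3⟩ := ih hw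
      exact ⟨.cons s q, h1.cons_cons _, h2.cons_cons _, by simp [Walk.starts, h, h3]⟩

/-- An edge of `q` has an end among the starts of `q`, but both ends of `s.edge` avoid them. The
edge of `t` is excluded separately because it may be parallel to that of `s`. -/
lemma Walk.edge_notMem {w u x v : Vertex k l} (s : Step w u) (t : Step u x) (q : Walk x v)
    (h : s.edge ≠ t.edge) (hu : u ∉ q.starts) (hw : w ∉ q.starts) :
    s.edge ∉ (Walk.cons t q).edges := by
  simp only [Walk.edges, List.mem_cons, h, false_or]
  intro he
  obtain ⟨y, hy, hi⟩ := q.exists_incident_of_mem_edges he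
  rcases s.incident_iff.1 hi with rfl | rfl
  · exact hw hy
  · exact hu hy

/-- Extend the walk backwards from `u` by the second edge of `ω` there: either the new vertex was
visited, which closes a cycle, or the walk grows. The final vertex is not in `starts`, so hitting it
may go unnoticed for one step, which is harmless. -/
lemma exists_isLoop_or_walk {ω : Finset (Edge k l)} (hω : IsLoopConfig ω) (hne : ω.Nonempty)
    (m : ℕ) : (∃ γ ⊆ ω, IsLoop γ) ∨ ∃ (u x v : Vertex k l) (s : Step u x) (p : Walk x v),
      p.edges.length = m ∧ (Walk.cons s p).edges.Nodup ∧ (Walk.cons s p).starts.Nodup ∧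
        ∀ e ∈ (Walk.cons s p).edges, e ∈ ω := by
  classical
  induction m with
  | zero =>
    obtain ⟨e, he⟩ := hne
    exact .inr ⟨_, _, _, .fwd e, .nil _, by simp [Walk.edges, Walk.starts, he, Step.edge]⟩
  | succ m ih =>
    rcases ih with ih | ⟨u, x, v, s, p, hlen, hn, hst, hmem⟩
    · exact .inl ih
    obtain ⟨i, hi⟩ := incident_iff.1 s.incident_left
    have hsω : s.edge ∈ ω := hmem _ (by simp [Walk.edges])
    obtain ⟨j, hji, hj⟩ := hω.exists_ne (hi ▸ hsω)
    obtain ⟨w, t, ht⟩ := exists_step (incident_iff.2 ⟨j, rfl⟩ : Incident u (star u j))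
    have hts : t.edge ≠ s.edge := by
      rw [ht, ← hi]
      exact fun h => hji (star_injective u h)
    have htω : t.edge ∈ ω := ht ▸ hj
    simp only [Walk.starts, List.nodup_cons] at hst
    by_cases hw : w ∈ p.starts
    · left
      obtain ⟨q, h1, h2, h3⟩ := p.exists_prefix hw
      have hu : u ∉ q.starts := fun h => hst.1 (h2.subset h)
      have hsub : ∀ e ∈ (Walk.cons t (Walk.cons s q)).edges, e ∈ ω := by
        intro e he
        simp only [Walk.edges, List.mem_cons] at he
        rcases he with rfl | rfl | he
        · exact htω
        · exact hsω
        · exact hmem e (by simp [Walk.edges, h1.subset he])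
      refine ⟨(Walk.cons t (Walk.cons s q)).edges.toFinset,
        fun e he => hsub e (List.mem_toFinset.1 he), w, .cons t (.cons s q), ⟨?_, ?_, ?_⟩, by simp⟩
      · simp [Walk.edges]
      · refine List.nodup_cons.2 ⟨Walk.edge_notMem t s q hts hu h3, ?_⟩
        exact hn.sublist (h1.cons_cons _)
      · simp only [Walk.starts, List.nodup_cons, List.mem_cons, not_or]
        exact ⟨⟨t.ne, h3⟩, hu, hst.2.sublist h2⟩
    · right
      refine ⟨w, u, v, t, .cons s p, by simp [Walk.edges, hlen], ?_, ?_, ?_⟩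
      · exact List.nodup_cons.2 ⟨Walk.edge_notMem t s p hts hst.1 hw, hn⟩
      · simp only [Walk.starts, List.nodup_cons, List.mem_cons, not_or]
        exact ⟨⟨t.ne, hw⟩, hst⟩
      · intro e he
        rcases List.mem_cons.1 he with rfl | he
        · exact htω
        · exact hmem e he

lemma IsLoopConfig.exists_isLoop {ω : Finset (Edge k l)} (hω : IsLoopConfig ω)
    (hne : ω.Nonempty) : ∃ γ ⊆ ω, IsLoop γ := by
  classical
  -- The first step adds one edge to the length, so the walk would have `ω.card + 1` distinct edges
  -- in `ω`.
  rcases exists_isLoop_or_walk hω hne ω.card with h | ⟨u, x, v, s, p, hlen, hn, -, hmem⟩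
  · exact h
  · exfalso
    have h1 := Finset.card_le_card (s := (Walk.cons s p).edges.toFinset) (t := ω)
      fun e he => hmem e (List.mem_toFinset.1 he)
    rw [List.toFinset_card_of_nodup hn] at h1
    simp [Walk.edges, hlen] at h1

/-! ### Even subgraphs of `ω` correspond to sets of loops of `ω` -/

lemma mem_loops {ω γ : Finset (Edge k l)} : γ ∈ loops ω ↔ γ ⊆ ω ∧ IsLoop γ := by
  simp [loops]

lemma loops_mono {ω η : Finset (Edge k l)} (h : ω ⊆ η) : loops ω ⊆ loops η := fun γ hγ => by
  rw [mem_loops] at *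
  exact ⟨hγ.1.trans h, hγ.2⟩

/-- The intersection is a nonempty even subgraph of both loops, and loops are minimal. -/
lemma IsLoopConfig.loop_eq {ω γ δ : Finset (Edge k l)} (hω : IsLoopConfig ω) (hγ : γ ∈ loops ω)
    (hδ : δ ∈ loops ω) {e : Edge k l} (h1 : e ∈ γ) (h2 : e ∈ δ) : γ = δ := by
  classical
  rw [mem_loops] at *
  have h := hω.inter hγ.2.isLoopConfig hδ.2.isLoopConfig hγ.1 hδ.1
  have hne : (γ ∩ δ).Nonempty := ⟨e, Finset.mem_inter.2 ⟨h1, h2⟩⟩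
  rw [← hγ.2.eq_of_subset h Finset.inter_subset_left hne]
  exact hδ.2.eq_of_subset h Finset.inter_subset_right hne

open Classical in
lemma IsLoopConfig.disjoint_sup {ω : Finset (Edge k l)} (hω : IsLoopConfig ω)
    {S T : Finset (Finset (Edge k l))} (hS : S ⊆ loops ω) (hT : T ⊆ loops ω) (h : Disjoint S T) :
    Disjoint (S.sup id) (T.sup id) := by
  rw [Finset.disjoint_left]
  intro e he he'
  simp only [Finset.mem_sup, id] at he he'
  obtain ⟨γ, hγ, he⟩ := he
  obtain ⟨δ, hδ, he'⟩ := he'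
  have := hω.loop_eq (hS hγ) (hT hδ) he he'
  exact Finset.disjoint_left.1 h hγ (this ▸ hδ)

open Classical in
lemma sup_subset {ω : Finset (Edge k l)} {S : Finset (Finset (Edge k l))} (hS : S ⊆ loops ω) :
    S.sup id ⊆ ω :=
  Finset.sup_le fun _ hγ => (mem_loops.1 (hS hγ)).1

open Classical in
lemma IsLoopConfig.sup {ω : Finset (Edge k l)} (hω : IsLoopConfig ω)
    {S : Finset (Finset (Edge k l))} (hS : S ⊆ loops ω) : IsLoopConfig (S.sup id) := by
  induction S using Finset.induction_on with
  | empty => exact IsLoopConfig.empty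
  | insert γ S hγ ih =>
    have h1 : γ ∈ loops ω := hS (Finset.mem_insert_self _ _)
    have h2 : S ⊆ loops ω := (Finset.subset_insert _ _).trans hS
    have h3 := hω.disjoint_sup (Finset.singleton_subset_iff.2 h1) h2
      (Finset.disjoint_singleton_left.2 hγ)
    rw [Finset.sup_insert]
    rw [Finset.sup_singleton] at h3
    exact (mem_loops.1 h1).2.isLoopConfig.union (ih h2) h3

open Classical in
lemma IsLoopConfig.loops_sup {ω : Finset (Edge k l)} (hω : IsLoopConfig ω)
    {S : Finset (Finset (Edge k l))} (hS : S ⊆ loops ω) : loops (S.sup id) = S := by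
  ext γ
  constructor
  · intro h
    have h' := mem_loops.1 h
    obtain ⟨e, he⟩ := h'.2.nonempty
    obtain ⟨δ, hδ, heδ⟩ := Finset.mem_sup.1 (h'.1 he)
    rw [hω.loop_eq (loops_mono (sup_subset hS) h) (hS hδ) he heδ]
    exact hδ
  · intro h
    exact mem_loops.2 ⟨Finset.le_sup (f := id) h, (mem_loops.1 (hS h)).2⟩

open Classical in
-- What the loops leave uncovered is even, so if nonempty it would contain another loop of `ω`.
lemma IsLoopConfig.sup_loops {ω : Finset (Edge k l)} (hω : IsLoopConfig ω) :
    (loops ω).sup id = ω := by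
  have hsub := sup_subset (Finset.Subset.refl (loops ω))
  refine hsub.antisymm ?_
  rw [← Finset.sdiff_eq_empty_iff_subset, ← Finset.not_nonempty_iff_eq_empty]
  intro hne
  obtain ⟨γ, hγ, hl⟩ := (hω.sdiff (hω.sup (Finset.Subset.refl _)) hsub).exists_isLoop hne
  obtain ⟨e, he⟩ := hl.nonempty
  have h1 := hγ he
  rw [Finset.mem_sdiff] at h1
  have h2 : γ ∈ loops ω := mem_loops.2 ⟨hγ.trans Finset.sdiff_subset, hl⟩
  exact h1.2 (Finset.mem_sup.2 ⟨γ, h2, he⟩)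

/-! ### Contractible cycles cross a closed curve an even number of times -/

lemma val_sub_one {m : ℕ} [NeZero m] (x : ZMod m) :
    ((x - 1).val : ℝ) = x.val - 1 + m * (if x = 0 then 1 else 0) := by
  have hm : 1 ≤ m := NeZero.one_le
  by_cases hx : x = 0
  · have h : x - 1 = ((m - 1 : ℕ) : ZMod m) := by
      rw [Nat.cast_sub hm]
      simp [hx]
    rw [h, ZMod.val_natCast_of_lt (by omega), Nat.cast_sub hm]
    simp [hx]
    ring
  · have h1 : 1 ≤ x.val := Nat.one_le_iff_ne_zero.2 fun h => hx ((ZMod.val_eq_zero x).1 h)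
    have h : x - 1 = ((x.val - 1 : ℕ) : ZMod m) := by
      rw [Nat.cast_sub h1]
      simp
    rw [h, ZMod.val_natCast_of_lt (by have := x.val_lt; omega), Nat.cast_sub h1]
    simp [hx]

/-- A real coordinate of a vertex in a fundamental domain. -/
noncomputable def height {m : ℕ} (c : Face k l → ZMod m) : Vertex k l → ℝ
  | .up f => (c f).val
  -- Relative to the face centre the coordinates are 1/3 and 2/3; the common 1/3 is dropped, as only
  -- differences of heights matter.
  | .down f => (c f).val + 1 / 3

/-- A coordinate of the plane that is compatible with the coordinate `c` of the faces, and the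
map from the torus to a circle that it induces. -/
structure IsCoordinate (m : ℕ) (i : Fin 3) (c : Face k l → ZMod m) (lam : ℂ →ₗ[ℝ] ℝ)
    (ψ : Torus k l →+ AddCircle (m : ℝ)) : Prop where
  continuous : Continuous ψ
  map_proj (z : ℂ) : ψ (proj k l z) = (lam z : ℝ)
  map_corner : lam corner = 1 / 3
  map_shiftC (j : Fin 3) : lam (shiftC j) = if j = i then 1 else 0
  sub_shift (f : Face k l) (j : Fin 3) : c (f - shift k l j) = c f - if j = i then 1 else 0

namespace IsCoordinate

variable {m : ℕ} {i : Fin 3} {c : Face k l → ZMod m} {lam : ℂ →ₗ[ℝ] ℝ}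
  {ψ : Torus k l →+ AddCircle (m : ℝ)}

lemma map_segment (h : IsCoordinate m i c lam ψ) (e : Edge k l) (t : unitInterval) :
    ψ (Edge.segment e t) =
      ψ e.upEnd.pos + ((t * (1 / 3 - if e.2 = i then 1 else 0) : ℝ) : AddCircle (m : ℝ)) := by
  have h1 : lam (((t : ℝ) : ℂ) * (corner - shiftC e.2)) =
      t * (1 / 3 - if e.2 = i then 1 else 0) := by
    rw [← Complex.real_smul, map_smul, map_sub, h.map_corner, h.map_shiftC, smul_eq_mul]
  change ψ (e.upEnd.pos + proj k l (((t : ℝ) : ℂ) * (corner - shiftC e.2))) = _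
  rw [map_add, h.map_proj, h1]

variable [NeZero m]

lemma height_downEnd (h : IsCoordinate m i c lam ψ) (e : Edge k l) :
    height c e.downEnd - height c e.upEnd = 1 / 3 - (if e.2 = i then 1 else 0) +
      m * (if e.2 = i ∧ c e.1 = 0 then 1 else 0) := by
  simp only [Edge.downEnd, Edge.upEnd, height, h.sub_shift]
  by_cases hi : e.2 = i
  · simp only [hi, if_true, true_and, val_sub_one]
    ring
  · simp [hi]

/-- `N` is the signed crossing number of the step with the curve where `c` jumps; the lift to the
line follows the height except for these jumps by `m`. -/
lemma exists_lift_step (h : IsCoordinate m i c lam ψ) {u v : Vertex k l} (s : Step u v) (x : ℝ)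
    (hx : (x : AddCircle (m : ℝ)) = ψ u.pos) :
    ∃ (y : ℝ) (Γ : Path x y) (N : ℤ), (∀ t, (Γ t : AddCircle (m : ℝ)) = ψ (s.curve t)) ∧
      y - x = height c v - height c u - m * N ∧
      (N : ZMod 2) = if s.edge.2 = i ∧ c s.edge.1 = 0 then 1 else 0 := by
  cases s with
  | fwd e =>
    refine ⟨x + (1 / 3 - if e.2 = i then 1 else 0),
      ⟨⟨fun t => x + t * (1 / 3 - if e.2 = i then 1 else 0), by fun_prop⟩, by simp, by simp⟩,
      if e.2 = i ∧ c e.1 = 0 then 1 else 0, fun t => ?_, ?_, ?_⟩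
    · refine Eq.trans ?_ (h.map_segment e t).symm
      rw [← hx, ← AddCircle.coe_add]
      rfl
    · rw [h.height_downEnd]
      push_cast
      ring
    · change _ = if e.2 = i ∧ c e.1 = 0 then (1 : ZMod 2) else 0
      split_ifs <;> simp
  | bwd e =>
    have h1 := h.map_segment e 1
    rw [Path.target, ← hx] at h1
    refine ⟨x - (1 / 3 - if e.2 = i then 1 else 0),
      ⟨⟨fun t => x - t * (1 / 3 - if e.2 = i then 1 else 0), by fun_prop⟩, by simp, by simp⟩,
      - if e.2 = i ∧ c e.1 = 0 then 1 else 0, fun t => ?_, ?_, ?_⟩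
    · refine Eq.trans ?_ (h.map_segment e (unitInterval.symm t)).symm
      rw [eq_sub_of_add_eq h1.symm, ← AddCircle.coe_sub, ← AddCircle.coe_add]
      congr 1
      simp only [Path.coe_mk_mk, unitInterval.coe_symm_eq, Set.Icc.coe_one]
      ring
    · rw [← neg_sub (height c _), h.height_downEnd]
      push_cast
      ring
    · change _ = if e.2 = i ∧ c e.1 = 0 then (1 : ZMod 2) else 0
      split_ifs <;> simp

lemma exists_lift (h : IsCoordinate m i c lam ψ) {u v : Vertex k l} (p : Walk u v) :
    ∀ x : ℝ, (x : AddCircle (m : ℝ)) = ψ u.pos →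
    ∃ (y : ℝ) (Γ : Path x y) (N : ℤ), (∀ t, (Γ t : AddCircle (m : ℝ)) = ψ (p.curve t)) ∧
      y - x = height c v - height c u - m * N ∧
      (N : ZMod 2) = (p.edges.map fun e => if e.2 = i ∧ c e.1 = 0 then 1 else 0).sum := by
  induction p with
  | nil u => exact fun x hx => ⟨x, Path.refl x, 0, by simp [Walk.curve, hx, Walk.edges]⟩
  | @cons u v w s p ih =>
    intro x hx
    obtain ⟨y, Γ, N, h1, h2, h3⟩ := h.exists_lift_step s x hx
    obtain ⟨z, Γ', N', h1', h2', h3'⟩ := ih y (by simpa using h1 1)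
    refine ⟨z, Γ.trans Γ', N + N', fun t => ?_, ?_, ?_⟩
    · simp only [Walk.curve, Path.trans_apply]
      split_ifs
      · exact h1 _
      · exact h1' _
    · push_cast
      linarith
    · simp [Walk.edges, h3, h3']

lemma sum_eq_zero (h : IsCoordinate m i c lam ψ) {v : Vertex k l} (p : Walk v v)
    (hp : p.curve.Homotopic (Path.refl v.pos)) :
    (p.edges.map fun e => if e.2 = i ∧ c e.1 = 0 then (1 : ZMod 2) else 0).sum = 0 := by
  obtain ⟨x, hx⟩ := QuotientAddGroup.mk_surjective (ψ v.pos)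
  obtain ⟨y, Γ, N, h1, h2, h3⟩ := h.exists_lift p x hx
  have cov := AddCircle.isCoveringMap_coe (m : ℝ)
  have hom : ((p.curve.map h.continuous).toContinuousMap).HomotopicRel
      ((Path.refl v.pos).map h.continuous).toContinuousMap {0, 1} := hp.map ⟨ψ, h.continuous⟩
  -- By homotopy lifting, the lift of the curve ends where the lift of the constant path does, so `y
  -- = x` and `m * N = 0`.
  have key :=
    cov.liftPath_apply_one_eq_of_homotopicRel hom x (by simp [hx.symm]) (by simp [hx.symm])
  have e1 := (cov.eq_liftPath_iff' (γ := (p.curve.map h.continuous).toContinuousMap) (e := x)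
    (Γ := Γ.toContinuousMap) (by simp [hx.symm])).2 ⟨funext fun t => h1 t, Γ.source⟩
  have e2 := (cov.eq_liftPath_iff' (γ := ((Path.refl v.pos).map h.continuous).toContinuousMap)
    (e := x) (Γ := .const _ x) (by simp [hx.symm])).2 ⟨funext fun t => hx, rfl⟩
  rw [← e1, ← e2] at key
  have hyx : y = x := Γ.target.symm.trans key
  have hN : (N : ℝ) = 0 := by
    have hm : (m : ℝ) ≠ 0 := NeZero.ne _
    rw [hyx, sub_self, sub_self, zero_sub, eq_comm, neg_eq_zero] at h2
    exact (mul_eq_zero.1 h2).resolve_left hm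
  rw [← h3, Int.cast_eq_zero.1 hN, Int.cast_zero]

end IsCoordinate

/-! ### The two lattice coordinates as maps from the torus to circles -/

lemma ζ_re : ζ.re = 1 / 2 := by
  rw [ζ, Complex.exp_ofReal_mul_I_re, Real.cos_pi_div_three]

lemma ζ_im : ζ.im = √3 / 2 := by
  rw [ζ, Complex.exp_ofReal_mul_I_im, Real.sin_pi_div_three]

/-- The coordinate `s` of the point `s + t ζ`. -/
noncomputable def coordLeft : ℂ →ₗ[ℝ] ℝ := Complex.reLm - (1 / √3) • Complex.imLm

/-- The coordinate `t` of the point `s + t ζ`. -/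
noncomputable def coordRight : ℂ →ₗ[ℝ] ℝ := (2 / √3) • Complex.imLm

@[simp] lemma coordLeft_one : coordLeft 1 = 1 := by simp [coordLeft]

@[simp] lemma coordLeft_ζ : coordLeft ζ = 0 := by
  simp [coordLeft, ζ_re, ζ_im]
  field_simp
  ring

@[simp] lemma coordRight_one : coordRight 1 = 0 := by simp [coordRight]

@[simp] lemma coordRight_ζ : coordRight ζ = 1 := by
  simp [coordRight, ζ_im]

/-- A linear form that sends both generating periods into the multiples of `m` descends to the
quotients. -/
lemma exists_circle_map {m : ℕ} (lam : ℂ →ₗ[ℝ] ℝ) (h1 : ((lam k : ℝ) : AddCircle (m : ℝ)) = 0)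
    (h2 : ((lam (l * ζ) : ℝ) : AddCircle (m : ℝ)) = 0) :
    ∃ ψ : Torus k l →+ AddCircle (m : ℝ), Continuous ψ ∧
      ∀ z : ℂ, ψ (proj k l z) = (lam z : ℝ) := by
  let φ : ℂ →+ AddCircle (m : ℝ) :=
    (QuotientAddGroup.mk' (AddSubgroup.zmultiples (m : ℝ))).comp lam.toAddMonoidHom
  have hφ : period k l ≤ φ.ker := by
    rw [period, AddSubgroup.closure_le]
    rintro z (rfl | rfl)
    · exact h1
    · exact h2
  refine ⟨QuotientAddGroup.lift _ φ hφ, ?_, fun z => rfl⟩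
  exact Continuous.quotient_lift
    ((AddCircle.continuous_mk' _).comp lam.continuous_of_finiteDimensional) _

lemma map_natCast_mul (lam : ℂ →ₗ[ℝ] ℝ) (n : ℕ) (z : ℂ) : lam (n * z) = n * lam z := by
  rw [← nsmul_eq_mul, map_nsmul, nsmul_eq_mul]

lemma exists_isCoordinate_left :
    ∃ ψ, IsCoordinate (k := k) (l := l) k 1 Prod.fst coordLeft ψ := by
  have h := map_natCast_mul coordLeft k 1
  rw [mul_one] at h
  obtain ⟨ψ, h1, h2⟩ := exists_circle_map (k := k) (l := l) (m := k) coordLeft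
    (by simp [h, AddCircle.coe_period]) (by simp [map_natCast_mul])
  refine ⟨ψ, h1, h2, ?_, fun j => ?_, fun f j => ?_⟩
  · have := map_natCast_mul coordLeft 3 corner
    simp only [corner, Nat.cast_ofNat] at this
    rw [mul_div_cancel₀ _ (by norm_num), map_add, coordLeft_one, coordLeft_ζ] at this
    rw [corner]
    linarith
  · fin_cases j <;> simp [shiftC]
  · fin_cases j <;> simp [shift]

lemma exists_isCoordinate_right :
    ∃ ψ, IsCoordinate (k := k) (l := l) l 2 Prod.snd coordRight ψ := by
  have h := map_natCast_mul coordRight k 1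
  rw [mul_one] at h
  obtain ⟨ψ, h1, h2⟩ := exists_circle_map (k := k) (l := l) (m := l) coordRight
    (by simp [h]) (by simp [map_natCast_mul, AddCircle.coe_period])
  refine ⟨ψ, h1, h2, ?_, fun j => ?_, fun f j => ?_⟩
  · have := map_natCast_mul coordRight 3 corner
    simp only [corner, Nat.cast_ofNat] at this
    rw [mul_div_cancel₀ _ (by norm_num), map_add, coordRight_one, coordRight_ζ] at this
    rw [corner]
    linarith
  · fin_cases j <;> simp [shiftC]
  · fin_cases j <;> simp [shift]

/-! ### Cocycles with values in the field with two elements -/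

/-- The six edges around a face, in cyclic order. -/
def boundary (g : Face k l) : Fin 6 → Edge k l :=
  ![(g, 1), (g - shift k l 1, 0), (g - shift k l 1, 2), (g - shift k l 2, 1),
    (g - shift k l 2, 0), (g, 2)]

/-- The sum of `a` around every face is zero. -/
def IsCocycle (a : Edge k l → ZMod 2) : Prop := ∀ g, ∑ j, a (boundary g j) = 0

/-- The coboundary of a function of the vertices. -/
def cobound (c : Vertex k l → ZMod 2) (e : Edge k l) : ZMod 2 := c e.upEnd + c e.downEnd

/-- The contribution of a face to the cup product, as a function of the values around the face. -/
def facePairing (x y : Fin 6 → ZMod 2) : ZMod 2 :=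
  -- Number the corners of the face so that edge `j` joins corner `j` to corner `j + 1`, with `up g`
  -- as corner 0. Then `x` is read between the `down` corners 1, 3, 5 and `y` from corner 0 to the
  -- `up` corners 2 and 4.
  (x 1 + x 2) * (y 0 + y 1) + (x 3 + x 4) * (y 0 + y 1 + y 2 + y 3)

/-- The cup product of two cocycles, evaluated on the torus. -/
def cup [NeZero k] [NeZero l] (a b : Edge k l → ZMod 2) : ZMod 2 :=
  ∑ g : Face k l, facePairing (fun j => a (boundary g j)) (fun j => b (boundary g j))

set_option synthInstance.maxSize 2000 in
set_option synthInstance.maxHeartbeats 200000 in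
set_option maxRecDepth 10000 in
-- If both vectors are nonzero, the conditions force each to be the indicator of two consecutive
-- edges, on opposite sides of the hexagon. The hypotheses are interleaved with the variables so
-- that `decide` prunes early.
lemma facePairing_eq_zero_aux : ∀ x0 y0 : ZMod 2, x0 * y0 = 0 → ∀ x1 y1 : ZMod 2,
    x1 * y1 = 0 → x0 * y1 = 0 → x1 * y0 = 0 → ∀ x2 y2 : ZMod 2,
    x2 * y2 = 0 → x1 * y2 = 0 → x2 * y1 = 0 → ∀ x3 y3 : ZMod 2,
    x3 * y3 = 0 → x2 * y3 = 0 → x3 * y2 = 0 → ∀ x4 y4 : ZMod 2,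
    x4 * y4 = 0 → x3 * y4 = 0 → x4 * y3 = 0 → ∀ x5 y5 : ZMod 2,
    x5 * y5 = 0 → x4 * y5 = 0 → x5 * y4 = 0 → x5 * y0 = 0 → x0 * y5 = 0 →
    x0 + x1 + x2 + x3 + x4 + x5 = 0 → y0 + y1 + y2 + y3 + y4 + y5 = 0 →
    (x1 + x2) * (y0 + y1) + (x3 + x4) * (y0 + y1 + y2 + y3) = 0 := by
  decide

lemma facePairing_eq_zero {x y : Fin 6 → ZMod 2} (hx : ∑ j, x j = 0) (hy : ∑ j, y j = 0)
    (h0 : ∀ j, x j * y j = 0) (h1 : ∀ j, x j * y (j + 1) = 0) (h2 : ∀ j, x (j + 1) * y j = 0) :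
    facePairing x y = 0 := by
  rw [Fin.sum_univ_six] at hx hy
  exact facePairing_eq_zero_aux _ _ (h0 0) _ _ (h0 1) (h1 0) (h2 0) _ _ (h0 2) (h1 1) (h2 1)
    _ _ (h0 3) (h1 2) (h2 2) _ _ (h0 4) (h1 3) (h2 3) _ _ (h0 5) (h1 4) (h2 4) (h1 5) (h2 5) hx hy

lemma isCocycle_cobound (c : Vertex k l → ZMod 2) : IsCocycle (cobound c) := by
  intro g
  have h2 : (2 : ZMod 2) = 0 := rfl
  have e : g - shift k l 2 - shift k l 1 = g - shift k l 1 - shift k l 2 := by abel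
  have h0 : shift k l 0 = 0 := rfl
  simp only [Fin.sum_univ_six, cobound, boundary, Edge.upEnd, Edge.downEnd, Matrix.cons_val, h0,
    sub_zero, e]
  linear_combination (c (.up g) + c (.down (g - shift k l 1)) + c (.up (g - shift k l 1)) +
    c (.down (g - shift k l 1 - shift k l 2)) + c (.up (g - shift k l 2)) +
    c (.down (g - shift k l 2))) * h2

lemma IsCocycle.add {a b : Edge k l → ZMod 2} (ha : IsCocycle a) (hb : IsCocycle b) :
    IsCocycle (a + b) := fun g => by
  simp only [Pi.add_apply, Finset.sum_add_distrib, ha g, hb g, add_zero]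

lemma sum_sub_right [NeZero k] [NeZero l] (F : Face k l → ZMod 2) (d : Face k l) :
    ∑ g, F (g - d) = ∑ g, F g := Equiv.sum_comp (Equiv.subRight d) F

lemma cup_add_left [NeZero k] [NeZero l] (a a' b : Edge k l → ZMod 2) :
    cup (a + a') b = cup a b + cup a' b := by
  simp only [cup, facePairing, ← Finset.sum_add_distrib, Pi.add_apply]
  exact Finset.sum_congr rfl fun g _ => by ring

lemma cup_add_right [NeZero k] [NeZero l] (a b b' : Edge k l → ZMod 2) :
    cup a (b + b') = cup a b + cup a b' := by
  simp only [cup, facePairing, ← Finset.sum_add_distrib, Pi.add_apply]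
  exact Finset.sum_congr rfl fun g _ => by ring

/-- A coboundary on the left enters only through `c` at the `down` corners. By the cocycle condition
the coefficient of a corner is the sum of `b` over the two edges of the face there; over the three
faces around the vertex each edge occurs twice. -/
lemma cup_cobound_left [NeZero k] [NeZero l] (c : Vertex k l → ZMod 2) {b : Edge k l → ZMod 2}
    (hb : IsCocycle b) : cup (cobound c) b = 0 := by
  have h2 : (2 : ZMod 2) = 0 := rfl
  have h0 : shift k l 0 = 0 := rfl
  set s := shift k l 1 with hs
  set t := shift k l 2 with ht
  let F1 : Face k l → ZMod 2 := fun h => c (.down h) * (b (h + s, 1) + b (h, 0))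
  let F2 : Face k l → ZMod 2 := fun h => c (.down h) * (b (h + t, 2) + b (h + s, 1))
  let F3 : Face k l → ZMod 2 := fun h => c (.down h) * (b (h, 0) + b (h + t, 2))
  have key : cup (cobound c) b = ∑ g, (F1 (g - s) + F2 (g - (s + t)) + F3 (g - t)) := by
    refine Finset.sum_congr rfl fun g _ => ?_
    have hg := hb g
    have e : g - t - s = g - s - t := by abel
    have e1 : g - (s + t) + t = g - s := by abel
    have e2 : g - (s + t) + s = g - t := by abel
    have e3 : g - s - t = g - (s + t) := by abel
    simp only [Fin.sum_univ_six, boundary, Matrix.cons_val, ← hs, ← ht] at hg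
    simp only [facePairing, cobound, boundary, Matrix.cons_val, Edge.upEnd, Edge.downEnd, ← hs,
      ← ht, h0, sub_zero, e, F1, F2, F3, sub_add_cancel, e1, e2, e3]
    linear_combination c (.down (g - t)) * hg +
      (c (.up (g - s)) * (b (g, 1) + b (g - s, 0)) +
       c (.up (g - t)) * (b (g, 1) + b (g - s, 0) + b (g - s, 2) + b (g - t, 1)) +
       c (.down (g - (s + t))) * (b (g, 1) + b (g - s, 0)) -
       c (.down (g - t)) * (b (g - t, 0) + b (g, 2))) * h2
  rw [key, Finset.sum_add_distrib, Finset.sum_add_distrib, sum_sub_right, sum_sub_right,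
    sum_sub_right, ← Finset.sum_add_distrib, ← Finset.sum_add_distrib]
  refine Finset.sum_eq_zero fun h _ => ?_
  simp only [F1, F2, F3]
  linear_combination c (.down h) * (b (h + s, 1) + b (h, 0) + b (h + t, 2)) * h2

/-- The same regrouping, now around the `up` corners. -/
lemma cup_cobound_right [NeZero k] [NeZero l] (c : Vertex k l → ZMod 2) {a : Edge k l → ZMod 2}
    (ha : IsCocycle a) : cup a (cobound c) = 0 := by
  have h2 : (2 : ZMod 2) = 0 := rfl
  have h0 : shift k l 0 = 0 := rfl
  set s := shift k l 1 with hs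
  set t := shift k l 2 with ht
  let F1 : Face k l → ZMod 2 := fun h => c (.up h) * (a (h, 0) + a (h, 2))
  let F2 : Face k l → ZMod 2 := fun h => c (.up h) * (a (h, 1) + a (h, 0))
  let F3 : Face k l → ZMod 2 := fun h => c (.up h) * (a (h, 1) + a (h, 2))
  have key : cup a (cobound c) = ∑ g, (F1 (g - s) + F2 (g - t) + F3 g) := by
    refine Finset.sum_congr rfl fun g _ => ?_
    have hg := ha g
    have e : g - t - s = g - s - t := by abel
    simp only [Fin.sum_univ_six, boundary, Matrix.cons_val, ← hs, ← ht] at hg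
    simp only [facePairing, cobound, boundary, Matrix.cons_val, Edge.upEnd, Edge.downEnd, ← hs,
      ← ht, h0, sub_zero, e, F1, F2, F3]
    linear_combination c (.up g) * hg + (-c (.up g) * (a (g, 1) + a (g, 2)) +
      c (.down (g - s)) * (a (g - s, 0) + a (g - s, 2)) +
      (a (g - t, 1) + a (g - t, 0)) * (c (.down (g - s)) + c (.up (g - s)) +
        c (.down (g - s - t)))) * h2
  rw [key, Finset.sum_add_distrib, Finset.sum_add_distrib, sum_sub_right, sum_sub_right,
    ← Finset.sum_add_distrib, ← Finset.sum_add_distrib]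
  refine Finset.sum_eq_zero fun h _ => ?_
  simp only [F1, F2, F3]
  linear_combination c (.up h) * (a (h, 0) + a (h, 1) + a (h, 2)) * h2

/-- Cocycles that are supported on edge sets without common vertices have cup product zero. -/
lemma cup_eq_zero [NeZero k] [NeZero l] {a b : Edge k l → ZMod 2} (ha : IsCocycle a)
    (hb : IsCocycle b) (h : ∀ (v : Vertex k l) (i j : Fin 3), a (star v i) * b (star v j) = 0) :
    cup a b = 0 := by
  refine Finset.sum_eq_zero fun g _ => ?_
  have h0 : shift k l 0 = 0 := rfl
  have e1 : g - shift k l 1 + shift k l 0 = g - shift k l 1 := by rw [h0, add_zero]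
  have e2 : g - shift k l 2 + shift k l 0 = g - shift k l 2 := by rw [h0, add_zero]
  have e3 : g - shift k l 1 - shift k l 2 + shift k l 2 = g - shift k l 1 := by abel
  have e4 : g - shift k l 1 - shift k l 2 + shift k l 1 = g - shift k l 2 := by abel
  have e5 : g - shift k l 1 + shift k l 1 = g := by abel
  have e6 : g - shift k l 2 + shift k l 2 = g := by abel
  have hup := fun f => h (.up f)
  have hdown := fun f => h (.down f)
  have h1 := hdown (g - shift k l 1)
  have h3 := hdown (g - shift k l 1 - shift k l 2)
  have h5 := hdown (g - shift k l 2)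
  simp only [star, Fin.forall_fin_succ, Fin.succ_zero_eq_one,
    Fin.succ_one_eq_two, Fin.isValue, e1, e2, e3, e4, e5, e6, IsEmpty.forall_iff, and_true]
    at hup h1 h3 h5
  have u1 := hup g
  have u2 := hup (g - shift k l 1)
  have u3 := hup (g - shift k l 2)
  refine facePairing_eq_zero (ha g) (hb g) ?_ ?_ ?_ <;> intro j <;> fin_cases j <;>
    simp only [boundary, Matrix.cons_val, Fin.isValue, Fin.reduceFinMk, Fin.zero_eta, Fin.mk_one,
      Fin.reduceAdd] <;> tauto

/-- The cocycle of the edges that cross the closed curve through the faces `(0, t)`. -/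
def crossLeft (k l : ℕ) (e : Edge k l) : ZMod 2 := if e.2 = 1 ∧ e.1.1 = 0 then 1 else 0

/-- The cocycle of the edges that cross the closed curve through the faces `(s, 0)`. -/
def crossRight (k l : ℕ) (e : Edge k l) : ZMod 2 := if e.2 = 2 ∧ e.1.2 = 0 then 1 else 0

lemma isCocycle_crossLeft : IsCocycle (crossLeft k l) := fun g => by
  simp [Fin.sum_univ_six, boundary, crossLeft, shift, CharTwo.add_self_eq_zero]

lemma isCocycle_crossRight : IsCocycle (crossRight k l) := fun g => by
  simp [Fin.sum_univ_six, boundary, crossRight, shift, CharTwo.add_self_eq_zero]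

/-- The two standard curves meet only in the face `0`, once. -/
lemma cup_cross [NeZero k] [NeZero l] : cup (crossLeft k l) (crossRight k l) = 1 := by
  have h (g : Face k l) : facePairing (fun j => crossLeft k l (boundary g j))
      (fun j => crossRight k l (boundary g j)) = if g = 0 then 1 else 0 := by
    by_cases h1 : g.1 = 0 <;> by_cases h2 : g.2 = 0 <;>
      simp [facePairing, boundary, crossLeft, crossRight, shift, h1, h2, Prod.ext_iff]
  simp [cup, h]

lemma sum_star_eq [DecidableEq (Vertex k l)] (v : Vertex k l) (e : Edge k l) :
    (∑ i, if star v i = e then (1 : ZMod 2) else 0) =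
      (if v = e.upEnd then 1 else 0) + (if v = e.downEnd then 1 else 0) := by
  obtain ⟨f, j⟩ := e
  cases v with
  | up g =>
    by_cases h : g = f <;> simp [star, Edge.upEnd, Edge.downEnd, h]
  | down g =>
    have h1 : ∀ i, ((g + shift k l i, i) : Edge k l) = (f, j) ↔ i = j ∧ g = f - shift k l j := by
      intro i
      rw [Prod.mk.injEq, eq_sub_iff_add_eq]
      constructor
      · rintro ⟨h, rfl⟩
        exact ⟨rfl, h⟩
      · rintro ⟨rfl, h⟩
        exact ⟨h, rfl⟩
    simp only [star, h1]
    by_cases h : g = f - shift k l j <;> simp [Edge.upEnd, Edge.downEnd, h]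

/-! ### Duality: disjoint even subgraphs cannot both block the torus -/

open Classical in
/-- A function that sums to zero over the even subgraphs off `B` is a coboundary off `B`. -/
lemma exists_cobound [NeZero k] [NeZero l] (a : Edge k l → ZMod 2) (B : Finset (Edge k l))
    (h : ∀ γ, IsLoopConfig γ → Disjoint γ B → ∑ e ∈ γ, a e = 0) :
    ∃ c : Vertex k l → ZMod 2, ∀ e ∉ B, a e = cobound c e := by
  let D : (Edge k l → ZMod 2) →ₗ[ZMod 2] (Vertex k l → ZMod 2) × (Edge k l → ZMod 2) :=
    { toFun := fun x => (fun v => ∑ i, x (star v i), fun e => if e ∈ B then x e else 0)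
      map_add' := fun x y => by
        ext v
        · simp [Finset.sum_add_distrib]
        · by_cases hv : v ∈ B <;> simp [hv]
      map_smul' := fun r x => by
        ext v
        · simp [Finset.mul_sum]
        · by_cases hv : v ∈ B <;> simp [hv] }
  let A : Module.Dual (ZMod 2) (Edge k l → ZMod 2) :=
    { toFun := fun x => ∑ e, a e * x e
      map_add' := fun x y => by simp [mul_add, Finset.sum_add_distrib]
      map_smul' := fun r x => by
        simp only [Pi.smul_apply, smul_eq_mul, Finset.mul_sum, RingHom.id_apply]
        exact Finset.sum_congr rfl fun e _ => by ring }
  -- The kernel of `D` consists of the indicators of even subgraphs off `B`. Since `A` vanishes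
  -- there, it factors through `D`.
  have hA : A ∈ LinearMap.range D.dualMap := by
    rw [LinearMap.range_dualMap_eq_dualAnnihilator_ker, Submodule.mem_dualAnnihilator]
    intro x hx
    have hx' := LinearMap.mem_ker.1 hx
    have h1 : ∀ v, ∑ i, x (star v i) = 0 := fun v => congr_fun (congr_arg Prod.fst hx') v
    have h2 : ∀ e ∈ B, x e = 0 := fun e he => by
      have : (if e ∈ B then x e else 0) = 0 := congr_fun (congr_arg Prod.snd hx') e
      simpa [he] using this
    have hxi : ∀ e, x e = ind (Finset.univ.filter fun e => x e ≠ 0) e := by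
      intro e
      by_cases he : x e = 0
      · simp [ind, he]
      · simp [ind, he]
        generalize x e = z at he
        revert z
        decide
    have h3 := h (Finset.univ.filter fun e => x e ≠ 0) ?_ ?_
    · rw [← h3, Finset.sum_filter]
      refine Finset.sum_congr rfl fun e _ => ?_
      nth_rw 1 [hxi e]
      by_cases he : x e = 0 <;> simp [ind, he]
    · rw [isLoopConfig_iff]
      intro v
      exact (Finset.sum_congr rfl fun i _ => (hxi _).symm).trans (h1 v)
    · rw [Finset.disjoint_left]
      intro e he he'
      exact (Finset.mem_filter.1 he).2 (h2 e he')
  obtain ⟨φ, hφ⟩ := hA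
  refine ⟨fun v => φ (Pi.single v 1, 0), fun e he => ?_⟩
  have h1 : A (Pi.single e 1) = a e := by
    simp [A, Pi.single_apply]
  have h2 : D (Pi.single e 1) = (Pi.single e.upEnd 1, 0) + (Pi.single e.downEnd 1, 0) := by
    ext v
    · simp only [D, LinearMap.coe_mk, AddHom.coe_mk, Prod.fst_add, Pi.add_apply, Pi.single_apply]
      exact sum_star_eq v e
    · by_cases hv : v = e
      · subst hv
        simp [D, he]
      · simp [D, hv]
  rw [cobound, ← map_add, ← h2, ← h1, ← hφ]
  rfl

/-- Of two disjoint even subgraphs, one leaves room for a noncontractible even subgraph. -/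
lemma exists_cross_ne_zero [NeZero k] [NeZero l] {B R : Finset (Edge k l)} (hB : IsLoopConfig B)
    (hR : IsLoopConfig R) (hd : Disjoint B R) :
    (∃ γ, IsLoopConfig γ ∧ Disjoint γ B ∧ ∑ e ∈ γ, crossLeft k l e ≠ 0) ∨
      ∃ γ, IsLoopConfig γ ∧ Disjoint γ R ∧ ∑ e ∈ γ, crossRight k l e ≠ 0 := by
  by_contra! hc
  obtain ⟨c, hca⟩ := exists_cobound _ B hc.1
  obtain ⟨d, hdb⟩ := exists_cobound _ R hc.2
  have h1 := isCocycle_crossLeft.add (isCocycle_cobound c) (k := k) (l := l)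
  have h2 := isCocycle_crossRight.add (isCocycle_cobound d) (k := k) (l := l)
  -- The modified cocycles are supported on `B` and on `R`, which have no common vertex.
  have h0 : cup (crossLeft k l + cobound c) (crossRight k l + cobound d) = 0 := by
    refine cup_eq_zero h1 h2 fun v i j => ?_
    by_cases hi : star v i ∈ B
    · rw [Pi.add_apply (crossRight k l), hdb _ (hB.star_notMem hR hd hi),
        CharTwo.add_self_eq_zero, mul_zero]
    · rw [Pi.add_apply, hca _ hi, CharTwo.add_self_eq_zero, zero_mul]
  rw [cup_add_left, cup_cobound_left c h2, add_zero, cup_add_right,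
    cup_cobound_right d isCocycle_crossLeft, cup_cross] at h0
  exact one_ne_zero h0

/-! ### Winding even subgraphs and winding loops -/

/-- The even subgraph `γ` crosses one of the two standard closed curves an odd number of times. -/
def Winds (γ : Finset (Edge k l)) : Prop :=
  ∑ e ∈ γ, crossLeft k l e ≠ 0 ∨ ∑ e ∈ γ, crossRight k l e ≠ 0

lemma IsLoop.isNoncontractibleLoop [NeZero k] [NeZero l] {γ : Finset (Edge k l)} (h : IsLoop γ)
    (hw : Winds γ) : IsNoncontractibleLoop γ := by
  obtain ⟨v, p, hp⟩ := h
  refine ⟨v, p, hp, fun hh => ?_⟩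
  obtain ⟨ψ, hl⟩ := exists_isCoordinate_left (k := k) (l := l)
  obtain ⟨χ, hr⟩ := exists_isCoordinate_right (k := k) (l := l)
  rcases hw with hw | hw
  · exact hw ((hp.sum_eq _).trans (hl.sum_eq_zero p hh))
  · exact hw ((hp.sum_eq _).trans (hr.sum_eq_zero p hh))

open Classical in
lemma sum_sdiff_ne_zero {ω γ : Finset (Edge k l)} (f : Edge k l → ZMod 2) (h : γ ⊆ ω)
    (h0 : ∑ e ∈ ω, f e ≠ 0) : ∑ e ∈ γ, f e ≠ 0 ∨ ∑ e ∈ ω \ γ, f e ≠ 0 := by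
  by_contra! hc
  exact h0 (by rw [← Finset.sum_sdiff h, hc.1, hc.2, add_zero])

/-- Crossing parity is additive: after removing a loop, either the loop or the rest still winds. -/
lemma IsLoopConfig.exists_winds {ω : Finset (Edge k l)} (hω : IsLoopConfig ω) (hw : Winds ω) :
    ∃ γ ∈ loops ω, Winds γ := by
  classical
  induction ω using Finset.strongInduction with
  | H ω ih =>
    have hne : ω.Nonempty := by
      rw [Finset.nonempty_iff_ne_empty]
      rintro rfl
      simp [Winds] at hw
    obtain ⟨γ, hγ, hl⟩ := hω.exists_isLoop hne
    have h : Winds γ ∨ Winds (ω \ γ) := by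
      rcases hw with hw | hw
      · exact (sum_sdiff_ne_zero _ hγ hw).imp .inl .inl
      · exact (sum_sdiff_ne_zero _ hγ hw).imp .inr .inr
    rcases h with h | h
    · exact ⟨γ, mem_loops.2 ⟨hγ, hl⟩, h⟩
    · obtain ⟨δ, hδ, hδw⟩ := ih _ (Finset.sdiff_ssubset hγ hl.nonempty)
        (hω.sdiff hl.isLoopConfig hγ) h
      exact ⟨δ, loops_mono Finset.sdiff_subset hδ, hδw⟩

open Classical in
lemma sum_symmDiff (ω η : Finset (Edge k l)) (f : Edge k l → ZMod 2) :
    ∑ e ∈ symmDiff ω η, f e = ∑ e ∈ ω, f e + ∑ e ∈ η, f e := by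
  have h1 := Finset.sum_sdiff (Finset.inter_subset_left : ω ∩ η ⊆ ω) (f := f)
  have h2 := Finset.sum_sdiff (Finset.inter_subset_right : ω ∩ η ⊆ η) (f := f)
  have h3 : ω \ (ω ∩ η) = ω \ η := by ext; simp
  have h4 : η \ (ω ∩ η) = η \ ω := by ext; simp
  have h5 : symmDiff ω η = (ω \ η) ∪ (η \ ω) := rfl
  have h2' : (2 : ZMod 2) = 0 := rfl
  rw [h5, Finset.sum_union disjoint_sdiff_sdiff, ← h1, ← h2, h3, h4]
  linear_combination (-∑ e ∈ ω ∩ η, f e) * h2'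

lemma Winds.or_symmDiff [DecidableEq (Edge k l)] {ω η : Finset (Edge k l)} (h : Winds η) :
    Winds ω ∨ Winds (symmDiff ω η) := by
  have key : ∀ f : Edge k l → ZMod 2, ∑ e ∈ η, f e ≠ 0 →
      ∑ e ∈ ω, f e ≠ 0 ∨ ∑ e ∈ symmDiff ω η, f e ≠ 0 := by
    intro f hf
    by_contra! hc
    have := sum_symmDiff ω η f
    rw [hc.1, zero_add] at this
    refine hf (this.symm.trans ?_)
    convert! hc.2
  rcases h with h | h
  · exact (key _ h).imp .inl .inl
  · exact (key _ h).imp .inr .inr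

/-- The even subgraphs of the torus that are disjoint from `B`. -/
noncomputable def evenOff [NeZero k] [NeZero l] (B : Finset (Edge k l)) :
    Finset (Finset (Edge k l)) := by
  classical exact Finset.univ.filter fun R => IsLoopConfig R ∧ Disjoint R B

lemma mem_evenOff [NeZero k] [NeZero l] {B R : Finset (Edge k l)} :
    R ∈ evenOff B ↔ IsLoopConfig R ∧ Disjoint R B := by
  simp [evenOff]

open Classical in
/-- If some even subgraph off `B` winds around the torus, then at least half of them do. -/
lemma card_evenOff_le [NeZero k] [NeZero l] {B : Finset (Edge k l)}
    (h : ∃ γ ∈ evenOff B, Winds γ) :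
    (evenOff B).card ≤ 2 * ((evenOff B).filter Winds).card := by
  obtain ⟨γ, hγ, hw⟩ := h
  rw [mem_evenOff] at hγ
  rw [← Finset.card_filter_add_card_filter_not (s := evenOff B) Winds, two_mul]
  refine Nat.add_le_add_left ?_ _
  -- Adding `γ` modulo 2 injects the subgraphs that do not wind into those that do.
  refine Finset.card_le_card_of_injOn (fun R => symmDiff R γ) (fun R hR => ?_) ?_
  · simp only [Finset.coe_filter, Set.mem_ofPred_eq, mem_evenOff] at hR ⊢
    refine ⟨⟨hR.1.1.symmDiff hγ.1, ?_⟩, hw.or_symmDiff.resolve_left hR.2⟩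
    exact (Disjoint.sup_left hR.1.2 hγ.2).mono_left symmDiff_le_sup
  · exact fun R _ R' _ h => symmDiff_left_injective γ h

/-! ### The colouring of the loops and the resulting inequalities -/

open Classical in
/-- Choose a random subset of `L` that contains each element with probability `t / (1 + t)`, where
`t ≤ 1`. If of any two disjoint sets at least one has the property `P`, then the random set has it
with probability at least one half. -/
lemma pow_le_two_mul_sum {ι : Type*} (L : Finset ι) (P : Finset ι → Prop) {t : ℝ} (h0 : 0 ≤ t)
    (h1 : t ≤ 1) (hP : ∀ A ⊆ L, ∀ B ⊆ L, Disjoint A B → P A ∨ P B) :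
    (1 + t) ^ L.card ≤ 2 * ∑ S ∈ L.powerset with P S, t ^ S.card := by
  -- A coupling of two disjoint copies: each element joins `S` with weight `t`, `A` with weight `t`,
  -- or neither with weight `1 - t`, which is nonnegative as `t ≤ 1`. Each marginal is `t ^ S.card`
  -- and the total mass `(1 + t) ^ L.card`.
  let w : Finset ι → Finset ι → ℝ := fun S A =>
    if Disjoint S A then t ^ S.card * (t ^ A.card * (1 - t) ^ (L.card - S.card - A.card)) else 0
  have hw : ∀ S ∈ L.powerset, ∑ A ∈ L.powerset, w S A = t ^ S.card := by
    intro S hS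
    rw [Finset.mem_powerset] at hS
    have h : L.powerset.filter (fun A => Disjoint S A) = (L \ S).powerset := by
      ext A
      rw [Finset.mem_filter, Finset.mem_powerset, Finset.mem_powerset, Finset.subset_sdiff,
        disjoint_comm]
    simp only [w]
    rw [← Finset.sum_filter, h, ← Finset.mul_sum, ← Finset.card_sdiff_of_subset hS,
      Finset.sum_pow_mul_eq_add_pow]
    simp
  have hsymm : ∀ S A, w S A = w A S := by
    intro S A
    simp only [w, disjoint_comm (a := S), Nat.sub_right_comm L.card S.card]
    split_ifs <;> ring
  have hw0 : ∀ S A, 0 ≤ w S A := by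
    intro S A
    simp only [w]
    split_ifs
    · have : 0 ≤ 1 - t := by linarith
      positivity
    · exact le_rfl
  let f : Finset ι → ℝ := fun S => if P S then 1 else 0
  have e1 : ∑ S ∈ L.powerset with P S, t ^ S.card =
      ∑ S ∈ L.powerset, ∑ A ∈ L.powerset, w S A * f S := by
    rw [Finset.sum_filter]
    refine Finset.sum_congr rfl fun S hS => ?_
    rw [← Finset.sum_mul, hw S hS]
    simp [f]
  have e2 : ∑ S ∈ L.powerset with P S, t ^ S.card =
      ∑ S ∈ L.powerset, ∑ A ∈ L.powerset, w S A * f A := by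
    rw [e1, Finset.sum_comm]
    simp only [hsymm]
  have e3 : (1 + t) ^ L.card = ∑ S ∈ L.powerset, ∑ A ∈ L.powerset, w S A := by
    rw [Finset.sum_congr rfl hw, add_comm, ← Finset.sum_pow_mul_eq_add_pow]
    simp
  rw [two_mul]
  nth_rw 1 [e1]
  rw [e2, e3, ← Finset.sum_add_distrib]
  refine Finset.sum_le_sum fun S hS => ?_
  rw [← Finset.sum_add_distrib]
  refine Finset.sum_le_sum fun A hA => ?_
  rw [← mul_add]
  by_cases hd : Disjoint S A
  · refine le_mul_of_one_le_right (hw0 _ _) ?_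
    rcases hP S (Finset.mem_powerset.1 hS) A (Finset.mem_powerset.1 hA) hd with h | h <;>
      simp only [f, h, if_true] <;> split_ifs <;> norm_num
  · simp [w, hd]

open Classical in
/-- A sum over sets of loops of `ω` as a sum over even subgraphs of `ω`. -/
lemma IsLoopConfig.sum_powerset_loops {ω : Finset (Edge k l)} (hω : IsLoopConfig ω)
    (Q : Finset (Edge k l) → Prop) (t : ℝ) :
    ∑ S ∈ (loops ω).powerset with Q (S.sup id), t ^ S.card =
      ∑ B ∈ ω.powerset with IsLoopConfig B ∧ Q B, t ^ (loops B).card := by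
  refine Finset.sum_bij' (fun S _ => S.sup id) (fun B _ => loops B) ?_ ?_ ?_ ?_ ?_
  · intro S hS
    simp only [Finset.mem_filter, Finset.mem_powerset] at hS ⊢
    exact ⟨sup_subset hS.1, hω.sup hS.1, hS.2⟩
  · intro B hB
    simp only [Finset.mem_filter, Finset.mem_powerset] at hB ⊢
    exact ⟨loops_mono hB.1, by rw [hB.2.1.sup_loops]; exact hB.2.2⟩
  · intro S hS
    simp only [Finset.mem_filter, Finset.mem_powerset] at hS
    exact hω.loops_sup hS.1
  · intro B hB
    simp only [Finset.mem_filter] at hB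
    exact hB.2.1.sup_loops
  · intro S hS
    simp only [Finset.mem_filter, Finset.mem_powerset] at hS
    rw [hω.loops_sup hS.1]

open Classical in
-- Binomial expansion of `((n - 1) + 1) ^ (loops ω).card` over the set of blue loops. For `n = 1`
-- only `B = ∅` contributes, through `0 ^ 0 = 1`.
lemma IsLoopConfig.pow_card_loops {ω : Finset (Edge k l)} (hω : IsLoopConfig ω) (n : ℝ) :
    n ^ (loops ω).card = ∑ B ∈ ω.powerset with IsLoopConfig B, (n - 1) ^ (loops B).card := by
  have h := hω.sum_powerset_loops (fun _ => True) (n - 1)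
  simp only [Finset.filter_true, and_true] at h
  rw [← h]
  have := Finset.sum_pow_mul_eq_add_pow (n - 1) 1 (loops ω)
  simp only [one_pow, mul_one, sub_add_cancel] at this
  exact this.symm

open Classical in
lemma IsLoopConfig.pow_card_loops_le [NeZero k] [NeZero l] {ω : Finset (Edge k l)}
    (hω : IsLoopConfig ω) {n : ℝ} (hn : n ∈ Set.Icc (1 : ℝ) 2) :
    n ^ (loops ω).card ≤ 2 * ∑ B ∈ ω.powerset with IsLoopConfig B ∧ ∃ γ ∈ evenOff B, Winds γ,
      (n - 1) ^ (loops B).card := by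
  have h' := hω.sum_powerset_loops (fun B => ∃ γ ∈ evenOff B, Winds γ) (n - 1)
  have h := pow_le_two_mul_sum (loops ω) (fun S => ∃ γ ∈ evenOff (S.sup id), Winds γ)
    (t := n - 1) (by linarith [hn.1]) (by linarith [hn.2]) ?_
  · rw [add_sub_cancel, h'] at h
    convert! h
  · intro A hA B hB hd
    rcases exists_cross_ne_zero (hω.sup hA) (hω.sup hB) (hω.disjoint_sup hA hB hd) with
      ⟨γ, h1, h2, h3⟩ | ⟨γ, h1, h2, h3⟩
    · exact .inl ⟨γ, mem_evenOff.2 ⟨h1, h2⟩, .inl h3⟩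
    · exact .inr ⟨γ, mem_evenOff.2 ⟨h1, h2⟩, .inr h3⟩

open Classical in
/-- Pairs of an even subgraph and an even part of it are pairs of disjoint even subgraphs. -/
lemma sum_pairs [NeZero k] [NeZero l] (F : Finset (Edge k l) → Finset (Edge k l) → ℝ) :
    ∑ ω : Finset (Edge k l) with IsLoopConfig ω, ∑ B ∈ ω.powerset with IsLoopConfig B,
        F B (ω \ B) =
      ∑ B : Finset (Edge k l) with IsLoopConfig B, ∑ R ∈ evenOff B, F B R := by
  rw [Finset.sum_sigma', Finset.sum_sigma']
  refine Finset.sum_bij' (fun x _ => ⟨x.2, x.1 \ x.2⟩) (fun x _ => ⟨x.2 ∪ x.1, x.1⟩) ?_ ?_ ?_ ?_ ?_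
  · rintro ⟨ω, B⟩ h
    simp only [Finset.mem_sigma, Finset.mem_filter, Finset.mem_univ, true_and,
      Finset.mem_powerset, mem_evenOff] at h ⊢
    exact ⟨h.2.2, h.1.sdiff h.2.2 h.2.1, Finset.sdiff_disjoint⟩
  · rintro ⟨B, R⟩ h
    simp only [Finset.mem_sigma, Finset.mem_filter, Finset.mem_univ, true_and,
      Finset.mem_powerset, mem_evenOff] at h ⊢
    exact ⟨h.2.1.union h.1 h.2.2, Finset.subset_union_right, h.1⟩
  · rintro ⟨ω, B⟩ h
    simp only [Finset.mem_sigma, Finset.mem_filter, Finset.mem_powerset] at h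
    simp [Finset.sdiff_union_of_subset h.2.1]
  · rintro ⟨B, R⟩ h
    simp only [Finset.mem_sigma, mem_evenOff] at h
    simp [Finset.union_sdiff_cancel_right h.2.2]
  · intros
    rfl

open Classical in
lemma partitionFunction_le [NeZero k] [NeZero l] {n : ℝ} (hn : n ∈ Set.Icc (1 : ℝ) 2) :
    partitionFunction k l n 1 ≤ 4 * ∑ ω : Finset (Edge k l) with IsLoopConfig ω ∧
      ∃ γ ∈ loops ω, IsNoncontractibleLoop γ, weight n 1 ω := by
  let g : Finset (Edge k l) → ℝ := fun B => (n - 1) ^ (loops B).card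
  have hg : ∀ B, 0 ≤ g B := fun B => pow_nonneg (by linarith [hn.1]) _
  let E : Finset (Edge k l) → Prop := fun B => ∃ γ ∈ evenOff B, Winds γ
  -- The blue part leaves room for a winding subgraph with probability at least 1/2.
  have h1 : partitionFunction k l n 1 ≤ 2 * ∑ B : Finset (Edge k l) with IsLoopConfig B,
      ∑ R ∈ evenOff B, if E B then g B else 0 := by
    rw [← sum_pairs (fun B _ => if E B then g B else 0), partitionFunction, Finset.mul_sum]
    refine Finset.sum_le_sum fun ω hω => ?_
    rw [weight, one_pow, one_mul]
    refine ((Finset.mem_filter.1 hω).2.pow_card_loops_le hn).trans_eq ?_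
    rw [← Finset.sum_filter, Finset.filter_filter]
    congr!
  -- Given such a blue part, the uniform red part winds with probability at least 1/2.
  have h2 : ∑ B : Finset (Edge k l) with IsLoopConfig B,
      (∑ R ∈ evenOff B, if E B then g B else 0) ≤
      2 * ∑ B : Finset (Edge k l) with IsLoopConfig B,
        ∑ R ∈ evenOff B, if Winds R then g B else 0 := by
    rw [Finset.mul_sum]
    refine Finset.sum_le_sum fun B _ => ?_
    rw [Finset.sum_const, nsmul_eq_mul, ← Finset.sum_filter, Finset.sum_const, nsmul_eq_mul,
      ← mul_assoc]
    by_cases hE : E B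
    · rw [if_pos hE]
      exact mul_le_mul_of_nonneg_right (by exact_mod_cast card_evenOff_le hE) (hg B)
    · rw [if_neg hE, mul_zero]
      exact mul_nonneg (by positivity) (hg B)
  -- A winding red part contains a noncontractible loop of `ω`; summing over all colourings restores
  -- the weight.
  have h3 : ∑ B : Finset (Edge k l) with IsLoopConfig B,
        (∑ R ∈ evenOff B, if Winds R then g B else 0) ≤
      ∑ ω : Finset (Edge k l) with IsLoopConfig ω ∧
        ∃ γ ∈ loops ω, IsNoncontractibleLoop γ, weight n 1 ω := by
    rw [← sum_pairs (fun B R => if Winds R then g B else 0), ← Finset.filter_filter,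
      Finset.sum_filter (fun ω => ∃ γ ∈ loops ω, IsNoncontractibleLoop γ)]
    refine Finset.sum_le_sum fun ω hω => ?_
    have hω' := (Finset.mem_filter.1 hω).2
    split_ifs with hnc
    · rw [weight, one_pow, one_mul, hω'.pow_card_loops]
      refine Finset.sum_le_sum fun B _ => ?_
      split_ifs
      exacts [le_rfl, hg B]
    · refine Finset.sum_nonpos fun B hB => ?_
      rw [Finset.mem_filter, Finset.mem_powerset] at hB
      rw [if_neg]
      intro hw
      obtain ⟨γ, hγ, hγw⟩ := (hω'.sdiff hB.2 hB.1).exists_winds hw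
      exact hnc ⟨γ, loops_mono Finset.sdiff_subset hγ,
        (mem_loops.1 hγ).2.isNoncontractibleLoop hγw⟩
  linarith

end LoopModel

theorem theorem1p7 (k l : ℕ) [NeZero k] [NeZero l] (n : ℝ) (hn : n ∈ Set.Icc (1 : ℝ) 2) :
    1 / 4 ≤ LoopModel.prob k l n 1
      {ω | ∃ γ ∈ LoopModel.loops ω, LoopModel.IsNoncontractibleLoop γ} := by
  classical
  have hpos : 0 < LoopModel.partitionFunction k l n 1 := by
    have hn0 : 0 < n := by linarith [hn.1]
    refine Finset.sum_pos (fun ω _ => ?_) ⟨∅, by simp [LoopModel.IsLoopConfig.empty]⟩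
    exact mul_pos (by positivity) (pow_pos hn0 _)
  have h := LoopModel.partitionFunction_le (k := k) (l := l) hn
  rw [LoopModel.prob, ← Finset.sum_div, le_div_iff₀ hpos]
  simp only [Set.mem_ofPred_eq]
  linarith
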